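/- Consider the MNL-Bandit problem with items $[N]=\{1,\dots,N\}$, revenues $r_i>0$ (known), attraction parameters $0<v_i\le v_0=1$ (unknown), and a non-empty family $\mathcal S$ of subsets of $[N]$ that is closed under taking subsets. When an assortment $S\subseteq[N]$ is offered, the customer buys $i\in S$ with probability $v_i/(1+\sum_{j\in S}v_j)$ and buys nothing with probability $1/(1+\sum_{j\in S}v_j)$. Algorithm 1 with horizon $T\ge1$ and parameter $\alpha\in[0,1/2]$ works in epochs. Put $v^{UCB}_{i,0}=1$. At the start of epoch $\ell=1,2,\dots$ it chooses $$S^*_\ell\in\arg\max_{S\in\mathcal S}\frac{\sum_{i\in S}r_iv^{UCB}_{i,\ell-1}}{1+\sum_{j\in S}v^{UCB}_{j,\ell-1}}$$ (ties broken arbitrarily, possibly depending on the past) and, with $\alpha_\ell=1/(2\ell^\alpha)$, draws $S_\ell=S^*_\ell$ with probability $1-\alpha_\ell$ and $S_\ell=[N]\setminus S^*_\ell$ with probability $\alpha_\ell$. It offers $S_\ell$ to one customer per time step until the first no-purchase, which ends the epoch $\mathcal E_\ell$. Let $\widehat v_{i,\ell}$ be the number of purchases of $i$ in epoch $\ell$,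 $T_i(\ell)$ the number of epochs $\tau\le\ell$ with $i\in S_\tau$, and $\overline v_{i,\ell}=\frac1{T_i(\ell)}\sum_{\tau\le\ell,\,i\in S_\tau}\widehat v_{i,\tau}$; then $$v^{UCB}_{i,\ell}=\overline v_{i,\ell}+\sqrt{\overline v_{i,\ell}\,\frac{48\log(\sqrt N\ell+1)}{T_i(\ell)}}+\frac{48\log(\sqrt N\ell+1)}{T_i(\ell)}$$ (and $v^{UCB}_{i,\ell}=1$ while $T_i(\ell)=0$). The algorithm performs the time steps $t=1,\dots,T-1$. With $L$ the number of epochs completed by then, i.e. the least $L\ge 0$ with $\sum_{\ell=1}^{L+1}|\mathcal E_\ell|\ge T$, it returns $$\widehat v_i=\frac1L\sum_{\ell=1}^L\frac{\widehat v_{i,\ell}\,\mathbf 1(i\in S_\ell)}{P(i\in S_\ell\mid S^*_\ell)}$$ (and $\widehat v_i=0$ if $L=0$), where $P(i\in S_\ell\mid S_\ell^*)$ is $1-\alpha_\ell$ if $i\in S^*_\ell$ and $\alpha_\ell$ otherwise. For $i\ne j$ let $\Delta_v^{(i,j)}=v_i-v_j$ and $\widehat\Delta_v^{(i,j)}=\widehat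 v_i-\widehat v_j$. Corollary 4.3. The estimation error of every parameter difference is $O(\sqrt{T^{\alpha-1}})$, in expectation and with high probability. That is, there are constants $C,c>0$ depending only on $N$ such that for all such $v,r,\mathcal S$, all tie-breaking rules, all $\alpha\in[0,1/2]$ and all $T\ge1$: 1. for all $i\ne j$ in $[N]$, $|\widehat\Delta_v^{(i,j)}-\Delta_v^{(i,j)}|$ is integrable and $$\mathbb E\left[\left|\widehat\Delta_v^{(i,j)}-\Delta_v^{(i,j)}\right|\right]\le C\sqrt{T^{\alpha-1}};$$ 2. for every $\delta\in[e^{-cT},1)$, with probability at least $1-\delta$, simultaneously for all $i\ne j$ in $[N]$, $$\left|\widehat\Delta_v^{(i,j)}-\Delta_v^{(i,j)}\right|\le C\ln\left(\frac2\delta\right)\sqrt{T^{\alpha-1}}.$$ -/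

import Mathlib

open scoped ENNReal

namespace MNLBandit

/-! ### Problem instances and the multinomial logit choice model -/

/-- An instance of the MNL-Bandit problem with `N` items. The attraction parameter of the
no-purchase option is `v₀ = 1`. The learner knows `r` and `family`, but not `v`. -/
structure Instance (N : ℕ) where
  /-- attraction parameters -/
  v : Fin N → ℝ
  /-- revenues -/
  r : Fin N → ℝ
  /-- the feasible assortments -/
  family : Finset (Finset (Fin N))
  v_pos : ∀ i, 0 < v i
  v_le_one : ∀ i, v i ≤ 1
  r_pos : ∀ i, 0 < r i
  family_nonempty : family.Nonempty
  family_hereditary : ∀ S ∈ family, ∀ Q, Q ⊆ S → Q ∈ family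

/-- The MNL probability of the choice `c` (`none` is the no-purchase option) when the
assortment `S` is offered. -/
noncomputable def choiceProb {N : ℕ} (v : Fin N → ℝ) (S : Finset (Fin N)) :
    Option (Fin N) → ℝ
  | none => 1 / (1 + ∑ j ∈ S, v j)
  | some i => if i ∈ S then v i / (1 + ∑ j ∈ S, v j) else 0

theorem choiceProb_nonneg {N : ℕ} {v : Fin N → ℝ} (hv : ∀ i, 0 < v i) (S : Finset (Fin N))
    (c : Option (Fin N)) : 0 ≤ choiceProb v S c := by
  have h : 0 ≤ ∑ j ∈ S, v j := Finset.sum_nonneg fun j _ => (hv j).le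
  cases c with
  | none => simp only [choiceProb]; positivity
  | some i =>
    simp only [choiceProb]
    split_ifs
    · exact div_nonneg (hv i).le (by linarith)
    · exact le_rfl

theorem sum_choiceProb {N : ℕ} {v : Fin N → ℝ} (hv : ∀ i, 0 < v i) (S : Finset (Fin N)) :
    ∑ c, choiceProb v S c = 1 := by
  have h : 0 ≤ ∑ j ∈ S, v j := Finset.sum_nonneg fun j _ => (hv j).le
  have h' : (1 + ∑ j ∈ S, v j) ≠ 0 := by linarith
  rw [Fintype.sum_option]
  simp only [choiceProb, Finset.sum_ite_mem, Finset.univ_inter, ← Finset.sum_div]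
  rw [← add_div, div_self h']

/-- The law of a customer's choice under the MNL model. -/
noncomputable def choiceLaw {N : ℕ} (I : Instance N) (S : Finset (Fin N)) :
    PMF (Option (Fin N)) :=
  PMF.ofFintype (fun c => ENNReal.ofReal (choiceProb I.v S c)) (by
    rw [← ENNReal.ofReal_sum_of_nonneg fun c _ => choiceProb_nonneg I.v_pos S c,
      sum_choiceProb I.v_pos S, ENNReal.ofReal_one])

/-! ### What the learner observes -/

/-- The record of one epoch: the optimistic assortment `S*`, the assortment `S` that is
actually offered throughout the epoch, and the items bought so far in the epoch
(the most recent one first). -/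
structure Epoch (N : ℕ) where
  opt : Finset (Fin N)
  offered : Finset (Fin N)
  purchases : List (Fin N)

/-- A history: the records of the completed epochs, the most recent one first. -/
abbrev History (N : ℕ) := List (Epoch N)

/-- The memory of the algorithm: the completed epochs and the running epoch. -/
structure State (N : ℕ) where
  past : History N
  current : Epoch N

instance (N : ℕ) : MeasurableSpace (State N) := ⊤

instance (N : ℕ) : DiscreteMeasurableSpace (State N) := ⟨fun _ => trivial⟩

/-! ### The optimistic assortment -/

/-- The number of completed epochs in which item `i` was offered. -/
def timesOffered {N : ℕ} (h : History N) (i : Fin N) : ℕ :=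
  (h.filter fun e => decide (i ∈ e.offered)).length

/-- The sample mean of the purchase counts of item `i` over the completed epochs
in which it was offered. -/
noncomputable def sampleMean {N : ℕ} (h : History N) (i : Fin N) : ℝ :=
  (((h.filter fun e => decide (i ∈ e.offered)).map fun e => e.purchases.count i).sum : ℝ)
    / timesOffered h i

/-- The upper confidence bound of item `i` after the epochs in `h`. As long as the item has
not been offered, it keeps its initial value `1`. -/
noncomputable def ucb {N : ℕ} (h : History N) (i : Fin N) : ℝ :=
  if timesOffered h i = 0 then 1
  else
    let b : ℝ := 48 * Real.log (Real.sqrt N * h.length + 1) / timesOffered h i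
    sampleMean h i + Real.sqrt (sampleMean h i * b) + b

/-- The expected revenue of the assortment `S` under revenues `r` and attraction
parameters `u`. -/
noncomputable def revenue {N : ℕ} (r u : Fin N → ℝ) (S : Finset (Fin N)) : ℝ :=
  (∑ i ∈ S, r i * u i) / (1 + ∑ j ∈ S, u j)

/-- `rule` selects, after each history, a feasible assortment of maximal optimistic revenue
(with arbitrary, possibly history-dependent, tie-breaking). -/
def IsOptimisticRule {N : ℕ} (I : Instance N) (rule : History N → Finset (Fin N)) : Prop :=
  ∀ h, rule h ∈ I.family ∧
    ∀ S ∈ I.family, revenue I.r (ucb h) S ≤ revenue I.r (ucb h) (rule h)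

/-! ### Forced exploration -/

/-- The probability `α_ℓ = 1 / (2 ℓ ^ α)` of offering the complement in epoch `ℓ`, where
`ℓ = h.length + 1` is the epoch that follows the history `h`. -/
noncomputable def explorationProb {N : ℕ} (α : ℝ) (h : History N) : ℝ :=
  1 / (2 * ((h.length + 1 : ℕ) : ℝ) ^ α)

theorem explorationProb_nonneg {N : ℕ} (α : ℝ) (h : History N) : 0 ≤ explorationProb α h := by
  unfold explorationProb
  positivity

theorem explorationProb_le_half {N : ℕ} {α : ℝ} (hα : 0 ≤ α) (h : History N) :
    explorationProb α h ≤ 1 / 2 := by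
  have h1 : (1 : ℝ) ≤ ((h.length + 1 : ℕ) : ℝ) ^ α :=
    Real.one_le_rpow (by exact_mod_cast Nat.succ_pos h.length) hα
  unfold explorationProb
  exact one_div_le_one_div_of_le (by norm_num) (by linarith)

/-- The exploration coin of the epoch that follows `h`: it shows `true` (explore) with
probability `α_ℓ` and `false` with probability `1 - α_ℓ`. -/
noncomputable def explorationCoin {N : ℕ} {α : ℝ} (hα : 0 ≤ α) (h : History N) : PMF Bool :=
  PMF.ofFintype
    (fun b => ENNReal.ofReal (if b then explorationProb α h else 1 - explorationProb α h)) (by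
    have h0 := explorationProb_nonneg α h
    have h1 := explorationProb_le_half hα h
    rw [Fintype.sum_bool, ← ENNReal.ofReal_add (by simpa using h0)
      (by simp only [Bool.false_eq_true, if_false]; linarith)]
    simp)

/-- The conditional probability `P(i ∈ S_ℓ | S*_ℓ = opt)` for the epoch that follows `h`. -/
noncomputable def propensity {N : ℕ} (α : ℝ) (h : History N) (opt : Finset (Fin N))
    (i : Fin N) : ℝ :=
  if i ∈ opt then 1 - explorationProb α h else explorationProb α h

/-! ### The algorithm -/

/-- After the completed epochs `h`, a new epoch starts: compute the optimistic assortment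
and offer it or its complement according to the exploration coin. -/
noncomputable def startEpoch {N : ℕ} (rule : History N → Finset (Fin N)) {α : ℝ} (hα : 0 ≤ α)
    (h : History N) : PMF (State N) :=
  (explorationCoin hα h).map fun explore =>
    { past := h
      current :=
        { opt := rule h
          offered := if explore then (rule h)ᶜ else rule h
          purchases := [] } }

/-- One time step: offer the assortment of the running epoch and observe the customer's
choice; a no-purchase ends the epoch. -/
noncomputable def step {N : ℕ} (I : Instance N) (rule : History N → Finset (Fin N)) {α : ℝ}
    (hα : 0 ≤ α) (s : State N) : PMF (State N) :=
  (choiceLaw I s.current.offered).bind fun c =>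
    match c with
    | some i => PMF.pure
        { past := s.past
          current :=
            { opt := s.current.opt
              offered := s.current.offered
              purchases := i :: s.current.purchases } }
    | none => startEpoch rule hα (s.current :: s.past)

/-- The law of the state after `n` time steps. -/
noncomputable def stateLaw {N : ℕ} (I : Instance N) (rule : History N → Finset (Fin N)) {α : ℝ}
    (hα : 0 ≤ α) : ℕ → PMF (State N)
  | 0 => startEpoch rule hα []
  | n + 1 => (stateLaw I rule hα n).bind (step I rule hα)

/-- The law of the final state of the algorithm with horizon `T`: the loop
`t = 1; while t < T do (one time step; t = t + 1)` performs `T - 1` time steps. The number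
of completed epochs in the final state is the number `L` that is minimal with
`|E_1| + ⋯ + |E_(L+1)| ≥ T`. -/
noncomputable def algorithmLaw {N : ℕ} (I : Instance N) (rule : History N → Finset (Fin N))
    {α : ℝ} (hα : 0 ≤ α) (T : ℕ) : MeasureTheory.Measure (State N) :=
  (stateLaw I rule hα (T - 1)).toMeasure

/-! ### The estimators -/

/-- The inverse-propensity weighted cumulative estimator `SumV` of item `i`. -/
noncomputable def sumV {N : ℕ} (α : ℝ) (i : Fin N) : History N → ℝ
  | [] => 0
  | e :: h => sumV α i h +
      if i ∈ e.offered then (e.purchases.count i : ℝ) / propensity α h e.opt i else 0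

/-- The returned estimate `SumV_L(i) / L` of `v i` (it is `0` if no epoch was completed). -/
noncomputable def vHat {N : ℕ} (α : ℝ) (s : State N) (i : Fin N) : ℝ :=
  sumV α i s.past / s.past.length

/-- The absolute error of the plug-in estimate of the difference `v i - v j`. -/
noncomputable def diffError {N : ℕ} (I : Instance N) (α : ℝ) (i j : Fin N) (s : State N) : ℝ :=
  |(vHat α s i - vHat α s j) - (I.v i - I.v j)|

end MNLBandit

/-! Write `M_i` for the cumulative error (estimate minus `v i`, summed over completed epochs), `L`
for their number, and `R = √(T^(α-1))`. Given that `i` is offered, its purchase count in an epoch is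
geometric with mean `v i` and moment generating function `1 / (1 - v i (e^a - 1))`.
Inverse-propensity weighting makes the epoch errors centred, and forced exploration keeps every
propensity at least `1/(2T^α)`, so each epoch contributes conditional variance `O(T^α)`. Hence `M_i`
is of order `√(T · T^α) = T R`, and division by `L ≍ T` gives the rate `R`.

The horizon is counted in customers, so `L` is random and the last epoch is incomplete. The argument
therefore runs on the Markov chain of single time steps. The conditional expectation of `exp(t M_i -
θL)` at the end of the running epoch is a supermartingale (`startMean_potential_le`,
`stepMean_potential_le`). With `t ≍ 1/(TR)` and `θ ≍ 1/T` the discount costs only a constant. The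
unfinished epoch is removed by AM-GM against an exponential moment of its length
(`mean_pow_purchases_le`). Every step ends an epoch with probability at least `1/(N+1)`, so `2^(-L)`
has exponentially small mean (`mean_half_pow_le`).

All these exponentials are added into one function `control` with mean bounded in terms of `N`. A
pointwise bound of the error by `R · control` gives the expectation; Markov's inequality for
`control`, followed by a logarithm, gives the tail for all pairs at once. -/

namespace PMF

/-! ### Expectations under a PMF, in `ℝ≥0∞` so that no summability is needed -/

variable {α β : Type*}

/-- The expectation of an extended nonnegative function under a probability mass function. -/
noncomputable def mean (p : PMF α) (f : α → ℝ≥0∞) : ℝ≥0∞ := ∑' a, p a * f a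

theorem mean_pure (a : α) (f : α → ℝ≥0∞) : (PMF.pure a).mean f = f a := by
  unfold mean
  rw [tsum_eq_single a]
  · simp
  · intro b hb
    simp [PMF.pure_apply, hb]

theorem mean_bind (p : PMF α) (q : α → PMF β) (f : β → ℝ≥0∞) :
    (p.bind q).mean f = p.mean fun a => (q a).mean f := by
  unfold mean
  simp only [PMF.bind_apply, ← ENNReal.tsum_mul_right, ← ENNReal.tsum_mul_left]
  rw [ENNReal.tsum_comm]
  simp only [mul_assoc]

theorem mean_map (p : PMF α) (g : α → β) (f : β → ℝ≥0∞) :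
    (p.map g).mean f = p.mean (f ∘ g) := by
  unfold PMF.map
  rw [mean_bind]
  simp only [Function.comp_apply, mean_pure]
  rfl

theorem mean_mono_support (p : PMF α) {f g : α → ℝ≥0∞} (h : ∀ a ∈ p.support, f a ≤ g a) :
    p.mean f ≤ p.mean g := by
  refine ENNReal.tsum_le_tsum fun a => ?_
  by_cases ha : p a = 0
  · simp [ha]
  · gcongr
    exact h a ((p.mem_support_iff a).2 ha)

theorem mean_add (p : PMF α) (f g : α → ℝ≥0∞) :
    (p.mean fun a => f a + g a) = p.mean f + p.mean g := by
  simp only [mean, mul_add, ENNReal.tsum_add]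

theorem mean_const_mul (p : PMF α) (c : ℝ≥0∞) (f : α → ℝ≥0∞) :
    (p.mean fun a => c * f a) = c * p.mean f := by
  simp only [mean, ← ENNReal.tsum_mul_left, mul_left_comm]

theorem mean_const (p : PMF α) (c : ℝ≥0∞) : (p.mean fun _ => c) = c := by
  simp only [mean, ENNReal.tsum_mul_right, p.tsum_coe, one_mul]

theorem mean_sum (p : PMF α) {ι : Type*} (s : Finset ι) (f : ι → α → ℝ≥0∞) :
    (p.mean fun a => ∑ i ∈ s, f i a) = ∑ i ∈ s, p.mean (f i) := by
  simp only [mean, Finset.mul_sum]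
  exact Summable.tsum_finsetSum fun _ _ => ENNReal.summable

theorem mean_ofFintype_ofReal [Fintype α] {w : α → ℝ} (hw : ∀ a, 0 ≤ w a)
    (h : ∑ a, ENNReal.ofReal (w a) = 1) {φ : α → ℝ} (hφ : ∀ a, 0 ≤ φ a) :
    (PMF.ofFintype (fun a => ENNReal.ofReal (w a)) h).mean (fun a => ENNReal.ofReal (φ a)) =
      ENNReal.ofReal (∑ a, w a * φ a) := by
  unfold mean
  rw [tsum_fintype, ENNReal.ofReal_sum_of_nonneg fun a _ => mul_nonneg (hw a) (hφ a)]
  exact Finset.sum_congr rfl fun a _ => by rw [PMF.ofFintype_apply, ENNReal.ofReal_mul (hw a)]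

theorem lintegral_toMeasure [MeasurableSpace α] [DiscreteMeasurableSpace α] (p : PMF α)
    (f : α → ℝ≥0∞) : ∫⁻ a, f a ∂p.toMeasure = p.mean f := by
  have h : p.toMeasure =
      MeasureTheory.Measure.sum fun a => p a • MeasureTheory.Measure.dirac a := by
    ext s hs
    rw [PMF.toMeasure_apply _ hs, MeasureTheory.Measure.sum_apply _ hs]
    refine tsum_congr fun a => ?_
    by_cases ha : a ∈ s <;> simp [ha]
  rw [h, MeasureTheory.lintegral_sum_measure]
  simp [mean]

end PMF

namespace MNLBandit

/-! ### One-step expectations and drift for the chain of time steps -/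

variable {N : ℕ}

/-- The state at the start of an epoch after the completed epochs `h`. -/
def freshState (rule : History N → Finset (Fin N)) (h : History N) (explore : Bool) : State N :=
  { past := h
    current :=
      { opt := rule h
        offered := if explore then (rule h)ᶜ else rule h
        purchases := [] } }

/-- The state after the purchase of item `i` in state `s`. -/
def State.buy (s : State N) (i : Fin N) : State N :=
  { past := s.past
    current :=
      { opt := s.current.opt
        offered := s.current.offered
        purchases := i :: s.current.purchases } }

/-- The expectation of `φ` at the start of the epoch after `h`. -/
noncomputable def startMean (rule : History N → Finset (Fin N)) (α : ℝ) (φ : State N → ℝ)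
    (h : History N) : ℝ :=
  explorationProb α h * φ (freshState rule h true) +
    (1 - explorationProb α h) * φ (freshState rule h false)

/-- The expectation of `φ` after one time step from `s`. -/
noncomputable def stepMean (I : Instance N) (rule : History N → Finset (Fin N)) (α : ℝ)
    (φ : State N → ℝ) (s : State N) : ℝ :=
  (startMean rule α φ (s.current :: s.past) + ∑ i ∈ s.current.offered, I.v i * φ (s.buy i)) /
    (1 + ∑ j ∈ s.current.offered, I.v j)

theorem startMean_nonneg (rule : History N → Finset (Fin N)) {α : ℝ} (hα : 0 ≤ α)
    {φ : State N → ℝ} (hφ : ∀ s, 0 ≤ φ s) (h : History N) : 0 ≤ startMean rule α φ h :=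
  add_nonneg (mul_nonneg (explorationProb_nonneg α h) (hφ _))
    (mul_nonneg (by linarith [explorationProb_le_half hα h]) (hφ _))

theorem mean_startEpoch (rule : History N → Finset (Fin N)) {α : ℝ} (hα : 0 ≤ α)
    {φ : State N → ℝ} (hφ : ∀ s, 0 ≤ φ s) (h : History N) :
    (startEpoch rule hα h).mean (fun s => ENNReal.ofReal (φ s)) =
      ENNReal.ofReal (startMean rule α φ h) := by
  unfold startEpoch explorationCoin
  have h0 := explorationProb_nonneg α h
  have h1 := explorationProb_le_half hα h
  rw [PMF.mean_map]
  refine (PMF.mean_ofFintype_ofReal (fun b => ?_) _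
    (φ := fun b => φ (freshState rule h b)) (fun b => hφ _)).trans ?_
  · cases b <;> simp <;> linarith
  · simp [startMean]

/-- Replaces the transition kernel by an explicit real formula, so that every later drift estimate
is real algebra. -/
theorem mean_step (I : Instance N) (rule : History N → Finset (Fin N)) {α : ℝ} (hα : 0 ≤ α)
    {φ : State N → ℝ} (hφ : ∀ s, 0 ≤ φ s) (s : State N) :
    (step I rule hα s).mean (fun s => ENNReal.ofReal (φ s)) =
      ENNReal.ofReal (stepMean I rule α φ s) := by
  unfold step choiceLaw
  rw [PMF.mean_bind]
  have key : ∀ c : Option (Fin N), PMF.mean (match c with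
      | some i => PMF.pure
        { past := s.past
          current :=
            { opt := s.current.opt
              offered := s.current.offered
              purchases := i :: s.current.purchases } }
      | none => startEpoch rule hα (s.current :: s.past)) (fun s => ENNReal.ofReal (φ s)) =
      ENNReal.ofReal (c.elim (startMean rule α φ (s.current :: s.past)) fun i => φ (s.buy i)) := by
    intro c
    cases c with
    | none => exact mean_startEpoch rule hα hφ _
    | some i => exact PMF.mean_pure _ _
  refine (congrArg (PMF.mean _) (funext key)).trans ?_
  rw [PMF.mean_ofFintype_ofReal (fun c => choiceProb_nonneg I.v_pos _ c)]
  · rw [Fintype.sum_option]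
    simp only [choiceProb, Option.elim, ite_mul, zero_mul, Finset.sum_ite_mem, Finset.univ_inter,
      stepMean, add_div, Finset.sum_div]
    congr 2
    · ring
    · exact Finset.sum_congr rfl fun i _ => by ring
  · intro c
    cases c with
    | none => exact startMean_nonneg rule hα hφ _
    | some i => exact hφ _

theorem sum_v_nonneg (I : Instance N) (S : Finset (Fin N)) : 0 ≤ ∑ j ∈ S, I.v j :=
  Finset.sum_nonneg fun j _ => (I.v_pos j).le

theorem sum_v_le (I : Instance N) (S : Finset (Fin N)) : ∑ j ∈ S, I.v j ≤ N := by
  calc ∑ j ∈ S, I.v j ≤ ∑ j ∈ S, (1 : ℝ) := Finset.sum_le_sum fun j _ => I.v_le_one j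
    _ = S.card := by simp
    _ ≤ N := by exact_mod_cast (Finset.card_le_univ S).trans_eq (Fintype.card_fin N)

/-- A time step completes at most one epoch. This keeps the epoch index at most `T`, which is what
bounds the decaying exploration probability from below. -/
theorem past_length_le (I : Instance N) (rule : History N → Finset (Fin N)) {α : ℝ} (hα : 0 ≤ α)
    (n : ℕ) : ∀ s ∈ (stateLaw I rule hα n).support, s.past.length ≤ n := by
  have hstart : ∀ h : History N, ∀ s ∈ (startEpoch rule hα h).support, s.past = h := by
    intro h s hs
    obtain ⟨b, -, rfl⟩ := (PMF.mem_support_map_iff _ _ _).1 hs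
    rfl
  induction n with
  | zero =>
    intro s hs
    rw [hstart [] s hs]
    rfl
  | succ n ih =>
    intro s hs
    obtain ⟨u, hu, hs⟩ := (PMF.mem_support_bind_iff _ _ _).1 hs
    obtain ⟨c, -, hs⟩ := (PMF.mem_support_bind_iff _ _ _).1 hs
    have := ih u hu
    cases c with
    | none =>
      rw [hstart _ s hs]
      simpa using this
    | some i =>
      rw [(PMF.mem_support_pure_iff _ _).1 hs]
      exact this.trans n.le_succ

theorem mean_stateLaw_zero (I : Instance N) (rule : History N → Finset (Fin N)) {α : ℝ}
    (hα : 0 ≤ α) {φ : State N → ℝ} (hφ : ∀ s, 0 ≤ φ s) :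
    (stateLaw I rule hα 0).mean (fun s => ENNReal.ofReal (φ s)) =
      ENNReal.ofReal (startMean rule α φ []) :=
  mean_startEpoch rule hα hφ []

/-- A one-step drift inequality on the reachable states gives a recursion for expectations. -/
theorem mean_stateLaw_succ_le (I : Instance N) (rule : History N → Finset (Fin N)) {α : ℝ}
    (hα : 0 ≤ α) {φ : State N → ℝ} (hφ : ∀ s, 0 ≤ φ s) {a b : ℝ} (ha : 0 ≤ a) (hb : 0 ≤ b) (n : ℕ)
    (hstep : ∀ s : State N, s.past.length ≤ n → stepMean I rule α φ s ≤ a * φ s + b) :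
    (stateLaw I rule hα (n + 1)).mean (fun s => ENNReal.ofReal (φ s)) ≤
      ENNReal.ofReal a * (stateLaw I rule hα n).mean (fun s => ENNReal.ofReal (φ s)) +
        ENNReal.ofReal b := by
  rw [stateLaw, PMF.mean_bind, ← PMF.mean_const_mul,
    ← PMF.mean_const (stateLaw I rule hα n) (ENNReal.ofReal b), ← PMF.mean_add]
  refine PMF.mean_mono_support _ fun s hs => ?_
  rw [mean_step I rule hα hφ, ← ENNReal.ofReal_mul ha, ← ENNReal.ofReal_add (mul_nonneg ha (hφ s)) hb]
  exact ENNReal.ofReal_le_ofReal (hstep s (past_length_le I rule hα n s hs))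

/-- The left side is a weighted average of `y` and `x` in which the no-purchase value `y` has weight
`1 / (1 + ∑ v)`. As `y ≤ x`, the worst case is total attraction `N`. -/
theorem sum_v_mul_le_div (I : Instance N) (S : Finset (Fin N)) {x y : ℝ} (hxy : y ≤ x) :
    (y + (∑ j ∈ S, I.v j) * x) / (1 + ∑ j ∈ S, I.v j) ≤ (y + N * x) / (1 + N) := by
  have h0 := sum_v_nonneg I S
  have h1 := sum_v_le I S
  rw [div_le_div_iff₀ (by linarith) (by linarith)]
  nlinarith [mul_nonneg (sub_nonneg.2 hxy) (sub_nonneg.2 h1)]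

/-! ### The running epoch is short -/

/-- A no-purchase, of probability at least `1/(N+1)`, resets the power to `1`; a purchase multiplies
it by `b`, which is close enough to `1` to leave a contraction. -/
theorem stepMean_pow_purchases_le (I : Instance N) (rule : History N → Finset (Fin N)) (α : ℝ)
    {b : ℝ} (hb : b = 1 + 1 / (2 * ((N : ℝ) + 1))) (s : State N) :
    stepMean I rule α (fun s => b ^ s.current.purchases.length) s ≤
      (1 - 1 / (2 * ((N : ℝ) + 1))) * b ^ s.current.purchases.length + 1 := by
  have hN : (0 : ℝ) ≤ N := N.cast_nonneg
  have hb1 : 1 ≤ b := by rw [hb]; linarith [show 0 ≤ 1 / (2 * ((N : ℝ) + 1)) by positivity]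
  have hx : 1 ≤ b ^ s.current.purchases.length := one_le_pow₀ hb1
  set x := b ^ s.current.purchases.length with hxdef
  have h1 : stepMean I rule α (fun s => b ^ s.current.purchases.length) s =
      (1 + (∑ j ∈ s.current.offered, I.v j) * (b * x)) /
        (1 + ∑ j ∈ s.current.offered, I.v j) := by
    simp only [stepMean, startMean, freshState, State.buy, List.length_nil, List.length_cons,
      pow_zero, pow_succ, Finset.sum_mul, hxdef]
    congr 2
    · ring
    · exact Finset.sum_congr rfl fun i _ => by ring
  rw [h1]
  refine (sum_v_mul_le_div I _ (by nlinarith)).trans ?_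
  rw [div_le_iff₀ (by linarith), hb]
  have h2 : (1 : ℝ) / (2 * (N + 1)) * (N + 1) = 1 / 2 := by field_simp
  set u := (1 : ℝ) / (2 * (N + 1)) with hu
  have hu0 : 0 ≤ u := by positivity
  nlinarith [mul_nonneg hu0 (zero_le_one.trans hx)]

theorem mean_pow_purchases_le (I : Instance N) (rule : History N → Finset (Fin N)) {α : ℝ}
    (hα : 0 ≤ α) {b : ℝ} (hb : b = 1 + 1 / (2 * ((N : ℝ) + 1))) (n : ℕ) :
    (stateLaw I rule hα n).mean
        (fun s => ENNReal.ofReal (b ^ s.current.purchases.length)) ≤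
      ENNReal.ofReal (2 * ((N : ℝ) + 1)) := by
  have hN : (0 : ℝ) ≤ N := N.cast_nonneg
  have hb0 : 0 ≤ b := by rw [hb]; positivity
  have hφ : ∀ s : State N, 0 ≤ b ^ s.current.purchases.length := fun s => pow_nonneg hb0 _
  induction n with
  | zero =>
    rw [mean_stateLaw_zero I rule hα (φ := fun s => b ^ s.current.purchases.length) hφ]
    refine ENNReal.ofReal_le_ofReal ?_
    simp only [startMean, freshState, List.length_nil, pow_zero]
    linarith
  | succ n ih =>
    have hu : 0 ≤ 1 - 1 / (2 * ((N : ℝ) + 1)) := by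
      rw [sub_nonneg, div_le_one (by positivity)]
      linarith
    refine (mean_stateLaw_succ_le I rule hα (φ := fun s => b ^ s.current.purchases.length) hφ
      hu zero_le_one n fun s _ => stepMean_pow_purchases_le I rule α hb s).trans ?_
    -- With `u = 1/(2(N+1))`, the bound `1/u` is the fixed point of `x ↦ (1 - u) x + 1`.
    refine (add_le_add_left (mul_le_mul_right ih _) _).trans ?_
    rw [← ENNReal.ofReal_mul hu, ← ENNReal.ofReal_add (by positivity) zero_le_one]
    refine ENNReal.ofReal_le_ofReal (le_of_eq ?_)
    field_simp
    ring

/-! ### Many epochs are completed -/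

/-- Completing an epoch halves the power, so the worst factor is `(1/2 + N)/(1 + N) = 1 -
1/(2(N+1))`. -/
theorem stepMean_half_pow_le (I : Instance N) (rule : History N → Finset (Fin N)) (α : ℝ)
    (s : State N) :
    stepMean I rule α (fun s => (1 / 2 : ℝ) ^ s.past.length) s ≤
      (1 - 1 / (2 * ((N : ℝ) + 1))) * (1 / 2 : ℝ) ^ s.past.length + 0 := by
  have hN : (0 : ℝ) ≤ N := N.cast_nonneg
  have hx : 0 ≤ (1 / 2 : ℝ) ^ s.past.length := by positivity
  set x := (1 / 2 : ℝ) ^ s.past.length with hxdef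
  have h1 : stepMean I rule α (fun s => (1 / 2 : ℝ) ^ s.past.length) s =
      (x / 2 + (∑ j ∈ s.current.offered, I.v j) * x) /
        (1 + ∑ j ∈ s.current.offered, I.v j) := by
    simp only [stepMean, startMean, freshState, State.buy, List.length_cons, pow_succ,
      Finset.sum_mul, hxdef]
    congr 2
    ring
  rw [h1]
  refine (sum_v_mul_le_div I _ (by linarith)).trans (le_of_eq ?_)
  field_simp
  ring

theorem mean_half_pow_le (I : Instance N) (rule : History N → Finset (Fin N)) {α : ℝ}
    (hα : 0 ≤ α) (n : ℕ) :
    (stateLaw I rule hα n).mean (fun s => ENNReal.ofReal ((1 / 2 : ℝ) ^ s.past.length)) ≤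
      ENNReal.ofReal ((1 - 1 / (2 * ((N : ℝ) + 1))) ^ n) := by
  have hN : (0 : ℝ) ≤ N := N.cast_nonneg
  have hφ : ∀ s : State N, 0 ≤ (1 / 2 : ℝ) ^ s.past.length := fun s => by positivity
  induction n with
  | zero =>
    rw [mean_stateLaw_zero I rule hα (φ := fun s => (1 / 2 : ℝ) ^ s.past.length) hφ]
    refine ENNReal.ofReal_le_ofReal (le_of_eq ?_)
    simp [startMean, freshState]
  | succ n ih =>
    have hu : 0 ≤ 1 - 1 / (2 * ((N : ℝ) + 1)) := by
      rw [sub_nonneg, div_le_one (by positivity)]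
      linarith
    refine (mean_stateLaw_succ_le I rule hα (φ := fun s => (1 / 2 : ℝ) ^ s.past.length) hφ
      hu le_rfl n fun s _ => stepMean_half_pow_le I rule α s).trans ?_
    rw [ENNReal.ofReal_zero, add_zero, pow_succ', ENNReal.ofReal_mul hu]
    gcongr

/-! ### The exponential supermartingale of the estimation error -/

/-- The cumulative error of the inverse-propensity weighted estimator over completed epochs. -/
noncomputable def cumError (I : Instance N) (α : ℝ) (i : Fin N) (h : History N) : ℝ :=
  sumV α i h - I.v i * h.length

/-- The exponential tilt of the cumulative error, discounted by `θ` for each epoch. -/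
noncomputable def tilt (I : Instance N) (α θ t : ℝ) (i : Fin N) (h : History N) : ℝ :=
  Real.exp (t * cumError I α i h - θ * h.length)

/-- The exponential potential: the tilt expected at the end of the running epoch. -/
noncomputable def potential (I : Instance N) (α θ t : ℝ) (i : Fin N) (s : State N) : ℝ :=
  tilt I α θ t i s.past * Real.exp (-θ - t * I.v i) *
    if i ∈ s.current.offered then
      Real.exp (t * (s.current.purchases.count i / propensity α s.past s.current.opt i)) /
        |1 - I.v i * (Real.exp (t / propensity α s.past s.current.opt i) - 1)|
    else 1

theorem tilt_cons (I : Instance N) (α θ t : ℝ) (i : Fin N) (e : Epoch N) (h : History N) :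
    tilt I α θ t i (e :: h) = tilt I α θ t i h * Real.exp (-θ - t * I.v i) *
      if i ∈ e.offered then Real.exp (t * (e.purchases.count i / propensity α h e.opt i))
      else 1 := by
  simp only [tilt, cumError, sumV, List.length_cons, Nat.cast_add, Nat.cast_one]
  split_ifs with hi
  · rw [← Real.exp_add, ← Real.exp_add]
    congr 1
    ring
  · rw [mul_one, ← Real.exp_add]
    congr 1
    ring

theorem explorationProb_pos (α : ℝ) (h : History N) : 0 < explorationProb α h := by
  unfold explorationProb
  have : (0 : ℝ) < ((h.length + 1 : ℕ) : ℝ) ^ α := Real.rpow_pos_of_pos (by positivity) _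
  positivity

/-- Forced exploration enters the error analysis here: the inverse weights are at most `1/α_ℓ`,
because `α_ℓ ≤ 1/2 ≤ 1 - α_ℓ`. -/
theorem explorationProb_le_propensity {α : ℝ} (hα : 0 ≤ α) (h : History N)
    (opt : Finset (Fin N)) (i : Fin N) : explorationProb α h ≤ propensity α h opt i := by
  unfold propensity
  split_ifs
  · linarith [explorationProb_le_half hα h]
  · exact le_rfl

theorem propensity_pos {α : ℝ} (hα : 0 ≤ α) (h : History N) (opt : Finset (Fin N))
    (i : Fin N) : 0 < propensity α h opt i :=
  (explorationProb_pos α h).trans_le (explorationProb_le_propensity hα h opt i)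

theorem abs_v_mul_exp_sub_one_le (I : Instance N) (i : Fin N) {a : ℝ} (ha : |a| ≤ 1 / 4) :
    |I.v i * (Real.exp a - 1)| ≤ 1 / 2 := by
  rw [abs_mul, abs_of_pos (I.v_pos i)]
  calc I.v i * |Real.exp a - 1| ≤ 1 * (2 * |a|) :=
        mul_le_mul (I.v_le_one i) (Real.abs_exp_sub_one_le (ha.trans (by norm_num)))
          (abs_nonneg _) zero_le_one
    _ ≤ 1 / 2 := by linarith

/-- Second-order bound for the geometric moment generating function. With `x = v (e^a - 1)` one has
`1/(1-x) ≤ 1 + x + 2x²`, `x ≤ v a + a²` and `x² ≤ 4a²`, whence `9 = 1 + 2·4`. -/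
theorem inv_one_sub_v_mul_exp_sub_one_le (I : Instance N) (i : Fin N) {a : ℝ}
    (ha : |a| ≤ 1 / 4) :
    (1 - I.v i * (Real.exp a - 1))⁻¹ ≤ 1 + I.v i * a + 9 * a ^ 2 := by
  have hv0 := I.v_pos i
  have hv1 := I.v_le_one i
  have hx := abs_le.1 (abs_v_mul_exp_sub_one_le I i ha)
  have h1 := abs_le.1 (Real.abs_exp_sub_one_sub_id_le (ha.trans (by norm_num)))
  have h2 : (I.v i * (Real.exp a - 1)) ^ 2 ≤ 4 * a ^ 2 := by
    have h3 : |I.v i * (Real.exp a - 1)| ≤ 2 * |a| := by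
      rw [abs_mul, abs_of_pos hv0]
      calc I.v i * |Real.exp a - 1| ≤ 1 * (2 * |a|) :=
          mul_le_mul hv1 (Real.abs_exp_sub_one_le (ha.trans (by norm_num)))
            (abs_nonneg _) zero_le_one
        _ = 2 * |a| := one_mul _
    calc (I.v i * (Real.exp a - 1)) ^ 2 = |I.v i * (Real.exp a - 1)| ^ 2 := (sq_abs _).symm
      _ ≤ (2 * |a|) ^ 2 := pow_le_pow_left₀ (abs_nonneg _) h3 2
      _ = 4 * a ^ 2 := by rw [mul_pow, sq_abs]; norm_num
  have h4 : I.v i * (Real.exp a - 1) ≤ I.v i * a + a ^ 2 := by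
    nlinarith [mul_le_mul_of_nonneg_left h1.2 hv0.le,
      mul_nonneg (sub_nonneg.2 hv1) (sq_nonneg a)]
  set x := I.v i * (Real.exp a - 1)
  have h5 : (1 - x)⁻¹ ≤ 1 + x + 2 * x ^ 2 := by
    rw [inv_le_iff_one_le_mul₀ (by linarith)]
    nlinarith [mul_nonneg (sq_nonneg x) (sub_nonneg.2 hx.2)]
  linarith

/-- The drift recursion asks for nonnegativity on all states, even unreachable ones where `t/p` is
not small; the absolute value in the denominator provides it. -/
theorem potential_nonneg (I : Instance N) (α θ t : ℝ) (i : Fin N) (s : State N) :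
    0 ≤ potential I α θ t i s := by
  refine mul_nonneg (mul_nonneg (Real.exp_pos _).le (Real.exp_pos _).le) ?_
  split_ifs
  · exact div_nonneg (Real.exp_pos _).le (abs_nonneg _)
  · exact zero_le_one

/-- Averaging over the coin gives `p/(1 - v(e^(t/p) - 1)) + (1 - p) ≤ 1 + t v + 9t²/p`. The linear
term is cancelled by the compensator `e^(-tv)` (unbiasedness of the weighting), the quadratic one by
the discount `e^(-θ)`. -/
theorem startMean_potential_le (I : Instance N) (rule : History N → Finset (Fin N)) {α θ t : ℝ}
    (hα : 0 ≤ α) (i : Fin N) (h : History N) (ht : |t| ≤ explorationProb α h / 4)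
    (hθ : 9 * t ^ 2 ≤ θ * explorationProb α h) :
    startMean rule α (potential I α θ t i) h ≤ tilt I α θ t i h := by
  have hp0 := propensity_pos hα h (rule h) i
  have hep := explorationProb_le_propensity hα h (rule h) i
  have he0 := explorationProb_pos α h
  set p := propensity α h (rule h) i with hp
  have hθ0 : 0 ≤ θ := by
    by_contra hneg
    nlinarith [mul_neg_of_neg_of_pos (not_le.1 hneg) he0, sq_nonneg t]
  have hθp : 9 * t ^ 2 ≤ θ * p := hθ.trans (mul_le_mul_of_nonneg_left hep hθ0)
  have ha : |t / p| ≤ 1 / 4 := by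
    rw [abs_div, abs_of_pos hp0, div_le_iff₀ hp0]
    linarith
  have hD := inv_one_sub_v_mul_exp_sub_one_le I i ha
  have habs : |1 - I.v i * (Real.exp (t / p) - 1)| = 1 - I.v i * (Real.exp (t / p) - 1) :=
    abs_of_pos (by linarith [(abs_le.1 (abs_v_mul_exp_sub_one_le I i ha)).2])
  have h1 : startMean rule α (potential I α θ t i) h =
      tilt I α θ t i h * Real.exp (-θ - t * I.v i) *
        (p * (1 - I.v i * (Real.exp (t / p) - 1))⁻¹ + (1 - p)) := by
    have hpe : p = if i ∈ rule h then 1 - explorationProb α h else explorationProb α h := hp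
    by_cases hi : i ∈ rule h
    · rw [if_pos hi] at hpe
      simp only [startMean, potential, freshState, if_true, Finset.mem_compl, hi, not_true,
        if_false, Bool.false_eq_true, List.count_nil, ← hp, habs]
      rw [hpe]
      simp only [Nat.cast_zero, zero_div, mul_zero, Real.exp_zero]
      ring
    · rw [if_neg hi] at hpe
      simp only [startMean, potential, freshState, if_true, Finset.mem_compl, hi, not_false_iff,
        if_false, Bool.false_eq_true, List.count_nil, ← hp, habs]
      rw [hpe]
      simp only [Nat.cast_zero, zero_div, mul_zero, Real.exp_zero]
      ring
  have h2 : p * (1 - I.v i * (Real.exp (t / p) - 1))⁻¹ + (1 - p) ≤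
      Real.exp (θ + t * I.v i) := by
    have h3 : p * (1 + I.v i * (t / p) + 9 * (t / p) ^ 2) = p + I.v i * t + 9 * t ^ 2 / p := by
      field_simp
    have h4 : 9 * t ^ 2 / p ≤ θ := by rwa [div_le_iff₀ hp0]
    have h5 := mul_le_mul_of_nonneg_left hD hp0.le
    have h6 := Real.add_one_le_exp (θ + t * I.v i)
    linarith
  rw [h1]
  have hT : 0 < tilt I α θ t i h := Real.exp_pos _
  calc _ ≤ tilt I α θ t i h * Real.exp (-θ - t * I.v i) * Real.exp (θ + t * I.v i) := by
        gcongr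
    _ = tilt I α θ t i h := by
      rw [mul_assoc, ← Real.exp_add, show -θ - t * I.v i + (θ + t * I.v i) = 0 by ring,
        Real.exp_zero, mul_one]

/-- By memorylessness of the geometric law the potential is an exact martingale inside an epoch; the
only loss is at the start of the next epoch, through `hstart`. -/
theorem stepMean_potential_le (I : Instance N) (rule : History N → Finset (Fin N)) {α θ t : ℝ}
    (i : Fin N) (s : State N)
    (hs : |t / propensity α s.past s.current.opt i| ≤ 1 / 4)
    (hstart : startMean rule α (potential I α θ t i) (s.current :: s.past) ≤
      tilt I α θ t i (s.current :: s.past)) :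
    stepMean I rule α (potential I α θ t i) s ≤ potential I α θ t i s := by
  have hx := abs_le.1 (abs_v_mul_exp_sub_one_le I i hs)
  have hV := sum_v_nonneg I s.current.offered
  rw [tilt_cons] at hstart
  unfold stepMean
  rw [div_le_iff₀ (by linarith)]
  by_cases hi : i ∈ s.current.offered
  · rw [if_pos hi] at hstart
    set p := propensity α s.past s.current.opt i with hp
    set B := tilt I α θ t i s.past * Real.exp (-θ - t * I.v i) *
      Real.exp (t * (s.current.purchases.count i / p)) with hB
    set D := 1 - I.v i * (Real.exp (t / p) - 1) with hD
    have hD0 : 0 < D := by linarith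
    have habs : |D| = D := abs_of_pos hD0
    have h1 : potential I α θ t i s = B / D := by
      simp only [potential, if_pos hi, ← hp, hB, ← hD, habs]
      ring
    have h2 : ∀ j, potential I α θ t i (s.buy j) =
        B / D + if i = j then (Real.exp (t / p) - 1) * (B / D) else 0 := by
      intro j
      simp only [potential, State.buy, if_pos hi, ← hp, List.count_cons, beq_iff_eq, ← hD, habs]
      by_cases hj : i = j
      · rw [if_pos hj.symm, if_pos hj, hB, Nat.cast_add, Nat.cast_one, add_div, mul_add,
          Real.exp_add, show t * (1 / p) = t / p by ring]
        ring
      · rw [if_neg (Ne.symm hj), if_neg hj, hB, Nat.add_zero]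
        ring
    simp only [h1, h2, mul_add, Finset.sum_add_distrib, ← Finset.sum_mul, mul_ite, mul_zero,
      Finset.sum_ite_eq, if_pos hi]
    -- Ending the epoch pays `B = D · (B/D)`; the missing `v i (e^(t/p) - 1) (B/D)` is exactly the
    -- gain from buying `i`.
    have h3 : B = D * (B / D) := by field_simp
    have h4 : D * (B / D) = B / D - I.v i * ((Real.exp (t / p) - 1) * (B / D)) := by
      rw [hD]; ring
    linarith
  · rw [if_neg hi] at hstart
    have h1 : potential I α θ t i s = tilt I α θ t i s.past * Real.exp (-θ - t * I.v i) * 1 := by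
      simp only [potential, if_neg hi]
    have h2 : ∀ j, potential I α θ t i (s.buy j) = potential I α θ t i s := by
      intro j
      rw [h1]
      simp only [potential, State.buy]
      exact congrArg _ (if_neg hi)
    simp only [h2, ← Finset.sum_mul]
    linarith

theorem mean_potential_le (I : Instance N) (rule : History N → Finset (Fin N)) {α θ t : ℝ}
    (hα : 0 ≤ α) (i : Fin N) {T : ℕ}
    (ht : ∀ h : History N, h.length + 1 ≤ T → |t| ≤ explorationProb α h / 4)
    (hθ : ∀ h : History N, h.length + 1 ≤ T → 9 * t ^ 2 ≤ θ * explorationProb α h) (n : ℕ)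
    (hn : n + 1 ≤ T) :
    (stateLaw I rule hα n).mean (fun s => ENNReal.ofReal (potential I α θ t i s)) ≤ 1 := by
  induction n with
  | zero =>
    rw [mean_stateLaw_zero I rule hα (potential_nonneg I α θ t i), ← ENNReal.ofReal_one]
    refine ENNReal.ofReal_le_ofReal ?_
    refine (startMean_potential_le I rule hα i [] (ht _ hn) (hθ _ hn)).trans (le_of_eq ?_)
    simp [tilt, cumError, sumV]
  | succ n ih =>
    refine (mean_stateLaw_succ_le I rule hα (potential_nonneg I α θ t i) zero_le_one le_rfl n
      fun s hs => ?_).trans ?_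
    · rw [one_mul, add_zero]
      have hp0 := propensity_pos hα s.past s.current.opt i
      have hlen : (s.current :: s.past).length + 1 ≤ T := by
        rw [List.length_cons]
        omega
      refine stepMean_potential_le I rule i s ?_
        (startMean_potential_le I rule hα i _ (ht _ hlen) (hθ _ hlen))
      rw [abs_div, abs_of_pos hp0, div_le_iff₀ hp0]
      linarith [ht s.past (by omega), explorationProb_le_propensity hα s.past s.current.opt i]
    · rw [ENNReal.ofReal_one, ENNReal.ofReal_zero, one_mul, add_zero]
      exact ih (by omega)

/-! ### An integrable control function -/

/-- The order of the estimation error. -/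
noncomputable def errorRate (α : ℝ) (T : ℕ) : ℝ := Real.sqrt ((T : ℝ) ^ (α - 1))

theorem errorRate_pos (α : ℝ) {T : ℕ} (hT : 1 ≤ T) : 0 < errorRate α T :=
  Real.sqrt_pos.2 (Real.rpow_pos_of_pos (by exact_mod_cast hT) _)

theorem errorRate_le_one {α : ℝ} (hα : α ≤ 1) {T : ℕ} (hT : 1 ≤ T) : errorRate α T ≤ 1 :=
  Real.sqrt_le_one.2
    (Real.rpow_le_one_of_one_le_of_nonpos (by exact_mod_cast hT) (by linarith))

/-- Lets the exploration floor `1/(2T^α)` be written as `1/(2TR²)`, after which the tilt estimates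
are rational in `T` and `R`. -/
theorem mul_errorRate_sq (α : ℝ) {T : ℕ} (hT : 1 ≤ T) :
    T * errorRate α T ^ 2 = (T : ℝ) ^ α := by
  have hT0 : (0 : ℝ) < T := by exact_mod_cast hT
  rw [errorRate, Real.sq_sqrt (Real.rpow_nonneg hT0.le _), Real.rpow_sub_one hT0.ne']
  field_simp

theorem one_le_mul_errorRate {α : ℝ} (hα : 0 ≤ α) (hα1 : α ≤ 1) {T : ℕ} (hT : 1 ≤ T) :
    1 ≤ T * errorRate α T := by
  have hT1 : (1 : ℝ) ≤ T := by exact_mod_cast hT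
  have h0 := errorRate_pos α hT
  calc (1 : ℝ) ≤ (T : ℝ) ^ α := Real.one_le_rpow hT1 hα
    _ = T * errorRate α T * errorRate α T := by rw [← mul_errorRate_sq α hT]; ring
    _ ≤ T * errorRate α T :=
      mul_le_of_le_one_right (by positivity) (errorRate_le_one hα1 hT)

/-- The scale of the exponential tilts. -/
noncomputable def tiltScale (N : ℕ) : ℝ := 1 / (8 * ((N : ℝ) + 1))

theorem tiltScale_pos (N : ℕ) : 0 < tiltScale N := by
  unfold tiltScale
  positivity

theorem tiltScale_le (N : ℕ) : tiltScale N ≤ 1 / 8 := by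
  unfold tiltScale
  exact one_div_le_one_div_of_le (by norm_num) (by linarith [(N.cast_nonneg : (0 : ℝ) ≤ N)])

/-- The exponential tilt for the horizon `T`. -/
noncomputable def tiltParam (N : ℕ) (α : ℝ) (T : ℕ) : ℝ := tiltScale N / (T * errorRate α T)

theorem tiltParam_pos (N : ℕ) (α : ℝ) {T : ℕ} (hT : 1 ≤ T) : 0 < tiltParam N α T :=
  div_pos (tiltScale_pos N) (mul_pos (by exact_mod_cast hT) (errorRate_pos α hT))

theorem inv_rpow_le_explorationProb {α : ℝ} (hα : 0 ≤ α) {T : ℕ} {h : History N}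
    (hh : h.length + 1 ≤ T) : 1 / (2 * (T * errorRate α T ^ 2)) ≤ explorationProb α h := by
  rw [mul_errorRate_sq α (by omega)]
  unfold explorationProb
  have h1 : (0 : ℝ) < ((h.length + 1 : ℕ) : ℝ) ^ α := Real.rpow_pos_of_pos (by positivity) _
  refine one_div_le_one_div_of_le (by positivity) ?_
  have h2 : ((h.length + 1 : ℕ) : ℝ) ^ α ≤ (T : ℝ) ^ α :=
    Real.rpow_le_rpow (by positivity) (by exact_mod_cast hh) hα
  linarith

theorem tiltParam_le {α : ℝ} (hα : 0 ≤ α) (hα1 : α ≤ 1) {T : ℕ} {h : History N}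
    (hh : h.length + 1 ≤ T) : tiltParam N α T ≤ 2 * tiltScale N * explorationProb α h := by
  have hT : 1 ≤ T := by omega
  have hT0 : (0 : ℝ) < T := by exact_mod_cast hT
  have hR := errorRate_pos α hT
  have hR1 := errorRate_le_one hα1 hT
  have hκ := tiltScale_pos N
  calc tiltParam N α T ≤ 2 * tiltScale N * (1 / (2 * (T * errorRate α T ^ 2))) := by
        rw [tiltParam, show 2 * tiltScale N * (1 / (2 * (T * errorRate α T ^ 2))) =
          tiltScale N / (T * errorRate α T ^ 2) by field_simp]
        refine div_le_div_of_nonneg_left hκ.le (by positivity) ?_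
        nlinarith [mul_pos hT0 hR]
    _ ≤ _ := mul_le_mul_of_nonneg_left (inv_rpow_le_explorationProb hα hh) (by positivity)

/-- This fixes the discount `θ = 18κ²/T`, with `κ` the tilt scale: it dominates the variance term
`9t²/p`, yet over at most `T` epochs it adds up to at most `18κ² < 1`. -/
theorem tiltParam_sq_le {α : ℝ} (hα : 0 ≤ α) {T : ℕ} {h : History N}
    (hh : h.length + 1 ≤ T) :
    9 * tiltParam N α T ^ 2 ≤ 18 * tiltScale N ^ 2 / T * explorationProb α h := by
  have hT : 1 ≤ T := by omega
  have hT0 : (0 : ℝ) < T := by exact_mod_cast hT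
  have hR := errorRate_pos α hT
  calc 9 * tiltParam N α T ^ 2 =
      18 * tiltScale N ^ 2 / T * (1 / (2 * (T * errorRate α T ^ 2))) := by
        rw [tiltParam]
        field_simp
        ring
    _ ≤ _ := mul_le_mul_of_nonneg_left (inv_rpow_le_explorationProb hα hh) (by positivity)

/-- The potential also carries the purchases of the unfinished epoch, which may reduce it by
`e^(-y)` with `y = |t/p| k`. Halving the exponent leaves room to split that factor off by AM-GM. -/
theorem exp_half_mul_cumError_le (I : Instance N) {α : ℝ} (hα : 0 ≤ α) (hα1 : α ≤ 1)
    {T : ℕ} (i : Fin N) (s : State N) (hs : s.past.length + 1 ≤ T) {t : ℝ}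
    (ht : |t| = tiltParam N α T) :
    Real.exp (t / 2 * cumError I α i s.past) ≤
      Real.exp 2 * potential I α (18 * tiltScale N ^ 2 / T) t i s +
        1 / 2 * (1 + 1 / (2 * ((N : ℝ) + 1))) ^ s.current.purchases.length := by
  have hT : 1 ≤ T := by omega
  have hT0 : (0 : ℝ) < T := by exact_mod_cast hT
  have hκ0 := tiltScale_pos N
  have hκ1 := tiltScale_le N
  have hp0 := propensity_pos hα s.past s.current.opt i
  have hep := explorationProb_le_propensity hα s.past s.current.opt i
  have htp : |t| ≤ 2 * tiltScale N * propensity α s.past s.current.opt i :=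
    ht.le.trans ((tiltParam_le hα hα1 hs).trans
      (mul_le_mul_of_nonneg_left hep (by positivity)))
  set p := propensity α s.past s.current.opt i with hp
  have htp' : |t / p| ≤ 2 * tiltScale N := by
    rwa [abs_div, abs_of_pos hp0, div_le_iff₀ hp0]
  have ht1 : |t| ≤ 1 := by
    have : explorationProb α s.past ≤ 1 / 2 := explorationProb_le_half hα _
    rw [ht]
    refine (tiltParam_le hα hα1 hs).trans ?_
    nlinarith [explorationProb_pos α s.past]
  set k : ℝ := ((s.current.purchases.count i : ℕ) : ℝ) with hk
  have hk0 : 0 ≤ k := Nat.cast_nonneg _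
  set θ := 18 * tiltScale N ^ 2 / T with hθ
  set y := |t / p| * k with hy
  have hy0 : 0 ≤ y := by positivity
  set u := t * cumError I α i s.past with hu
  have hθT : θ * (s.past.length + 1) ≤ 1 := by
    have h1 : ((s.past.length : ℝ) + 1) ≤ T := by exact_mod_cast hs
    have h2 : θ * T = 18 * tiltScale N ^ 2 := by rw [hθ]; field_simp
    have h3 : θ * (s.past.length + 1) ≤ θ * T :=
      mul_le_mul_of_nonneg_left h1 (by rw [hθ]; positivity)
    nlinarith
  -- The factor `e²` pays for `θ(L+1) ≤ 1` and `t v ≤ 1`, the factor `2` for the denominator of the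
  -- potential.
  have hpot : Real.exp (u - y) ≤ 2 * Real.exp 2 * potential I α θ t i s := by
    have hX : Real.exp (-y) / 2 ≤ if i ∈ s.current.offered then
        Real.exp (t * (k / p)) / |1 - I.v i * (Real.exp (t / p) - 1)| else 1 := by
      split_ifs
      · have hx := abs_le.1 (abs_v_mul_exp_sub_one_le I i (htp'.trans (by linarith)))
        have hD : |1 - I.v i * (Real.exp (t / p) - 1)| ≤ 2 := abs_le.2 ⟨by linarith, by linarith⟩
        have hD0 : 0 < |1 - I.v i * (Real.exp (t / p) - 1)| := abs_pos.2 (by linarith)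
        refine div_le_div₀ (Real.exp_pos _).le (Real.exp_le_exp.2 ?_) hD0 hD
        rw [show t * (k / p) = t / p * k by ring, hy, ← neg_mul]
        exact mul_le_mul_of_nonneg_right (neg_abs_le _) hk0
      · linarith [Real.exp_le_one_iff.2 (neg_nonpos.2 hy0)]
    have hv : t * I.v i ≤ 1 := by
      have h1 := I.v_pos i
      have h2 := I.v_le_one i
      calc t * I.v i ≤ |t| * I.v i := mul_le_mul_of_nonneg_right (le_abs_self t) h1.le
        _ ≤ 1 * 1 := mul_le_mul ht1 h2 h1.le zero_le_one
        _ = 1 := one_mul 1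
    calc Real.exp (u - y) = 2 * Real.exp 2 * (Real.exp (u - 2) * (Real.exp (-y) / 2)) := by
          rw [show 2 * Real.exp 2 * (Real.exp (u - 2) * (Real.exp (-y) / 2)) =
            Real.exp 2 * (Real.exp (u - 2) * Real.exp (-y)) by ring, ← Real.exp_add,
            ← Real.exp_add]
          congr 1
          ring
      _ ≤ 2 * Real.exp 2 * potential I α θ t i s := by
          refine mul_le_mul_of_nonneg_left ?_ (by positivity)
          unfold potential
          refine mul_le_mul ?_ hX (by positivity)
            (mul_nonneg (Real.exp_pos _).le (Real.exp_pos _).le)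
          rw [tilt, ← Real.exp_add]
          refine Real.exp_le_exp.2 ?_
          linarith
  have hb : Real.exp y ≤ (1 + 1 / (2 * ((N : ℝ) + 1))) ^ s.current.purchases.length := by
    have h1 : Real.exp (2 * tiltScale N) ≤ 1 + 1 / (2 * ((N : ℝ) + 1)) := by
      have h2 := (abs_le.1 (Real.abs_exp_sub_one_le (x := 2 * tiltScale N)
        (abs_le.2 ⟨by linarith, by linarith⟩))).2
      rw [abs_of_pos (by linarith)] at h2
      -- The tilt scale `1/(8(N+1))` is chosen for this equality, so that `e^y` is controlled by the
      -- purchase-length moment.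
      have h3 : 2 * (2 * tiltScale N) = 1 / (2 * ((N : ℝ) + 1)) := by
        rw [tiltScale]
        field_simp
        norm_num
      linarith
    calc Real.exp y ≤ Real.exp (s.current.purchases.count i * (2 * tiltScale N)) := by
          refine Real.exp_le_exp.2 ?_
          rw [hy, mul_comm]
          exact mul_le_mul_of_nonneg_left htp' hk0
      _ = Real.exp (2 * tiltScale N) ^ s.current.purchases.count i := Real.exp_nat_mul _ _
      _ ≤ (1 + 1 / (2 * ((N : ℝ) + 1))) ^ s.current.purchases.count i :=
          pow_le_pow_left₀ (Real.exp_pos _).le h1 _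
      _ ≤ _ := pow_le_pow_right₀ (by
          linarith [show 0 ≤ 1 / (2 * ((N : ℝ) + 1)) by positivity]) List.count_le_length
  have hamgm : Real.exp (t / 2 * cumError I α i s.past) ≤
      1 / 2 * (Real.exp (u - y) + Real.exp y) := by
    have h1 : Real.exp (t / 2 * cumError I α i s.past) =
        Real.exp ((u - y) / 2) * Real.exp (y / 2) := by
      rw [← Real.exp_add, hu]
      congr 1
      ring
    have h2 : ∀ x : ℝ, Real.exp x = Real.exp (x / 2) ^ 2 := fun x => by
      rw [sq, ← Real.exp_add, add_halves]
    rw [h1, h2 (u - y), h2 y]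
    nlinarith [sq_nonneg (Real.exp ((u - y) / 2) - Real.exp (y / 2))]
  linarith

theorem mean_exp_half_mul_cumError_le (I : Instance N) (rule : History N → Finset (Fin N))
    {α : ℝ} (hα : 0 ≤ α) (hα1 : α ≤ 1) {T n : ℕ} (hn : n + 1 ≤ T) (i : Fin N) {t : ℝ}
    (ht : |t| = tiltParam N α T) :
    (stateLaw I rule hα n).mean
        (fun s => ENNReal.ofReal (Real.exp (t / 2 * cumError I α i s.past))) ≤
      ENNReal.ofReal (Real.exp 2 + (N + 1)) := by
  set b : ℝ := 1 + 1 / (2 * ((N : ℝ) + 1)) with hb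
  have hb0 : 0 ≤ b := by positivity
  have hκ1 := tiltScale_le N
  calc _ ≤ (stateLaw I rule hα n).mean (fun s => ENNReal.ofReal (Real.exp 2) *
            ENNReal.ofReal (potential I α (18 * tiltScale N ^ 2 / T) t i s) +
          ENNReal.ofReal (1 / 2) * ENNReal.ofReal (b ^ s.current.purchases.length)) := by
        refine PMF.mean_mono_support _ fun s hs => ?_
        have hlen := past_length_le I rule hα n s hs
        have hpot := potential_nonneg I α (18 * tiltScale N ^ 2 / T) t i s
        rw [← ENNReal.ofReal_mul (Real.exp_pos _).le, ← ENNReal.ofReal_mul (by norm_num),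
          ← ENNReal.ofReal_add (by positivity) (by positivity)]
        exact ENNReal.ofReal_le_ofReal
          (exp_half_mul_cumError_le I hα hα1 i s (by omega) ht)
    _ ≤ ENNReal.ofReal (Real.exp 2) * 1 +
          ENNReal.ofReal (1 / 2) * ENNReal.ofReal (2 * ((N : ℝ) + 1)) := by
        rw [PMF.mean_add, PMF.mean_const_mul, PMF.mean_const_mul]
        gcongr
        · refine mean_potential_le I rule hα i (T := T) (fun h hh => ?_) (fun h hh => ?_) n hn
          · rw [ht]
            refine (tiltParam_le hα hα1 hh).trans ?_
            nlinarith [explorationProb_pos α h]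
          · rw [← sq_abs, ht]
            exact tiltParam_sq_le hα hh
        · exact mean_pow_purchases_le I rule hα hb n
    _ = ENNReal.ofReal (Real.exp 2 + (N + 1)) := by
        rw [mul_one, ← ENNReal.ofReal_mul (by norm_num),
          ← ENNReal.ofReal_add (Real.exp_pos _).le (by positivity)]
        congr 1
        ring

/-- A function that is large whenever the estimation error is, or few epochs are completed. -/
noncomputable def control (I : Instance N) (α : ℝ) (T : ℕ) (s : State N) : ℝ :=
  ∑ i, (Real.exp (tiltParam N α T / 2 * cumError I α i s.past) +
      Real.exp (-tiltParam N α T / 2 * cumError I α i s.past)) +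
    ((1 - 1 / (2 * ((N : ℝ) + 1))) ^ (T - 1))⁻¹ * (1 / 2) ^ s.past.length

/-- A bound for the expectation of `control`. -/
noncomputable def controlBound (N : ℕ) : ℝ := N * (2 * (Real.exp 2 + (N + 1))) + 1

theorem one_le_controlBound (N : ℕ) : 1 ≤ controlBound N := by
  have : 0 ≤ (N : ℝ) * (2 * (Real.exp 2 + (N + 1))) := by positivity
  unfold controlBound
  linarith

theorem one_sub_pos (N : ℕ) : 0 < 1 - 1 / (2 * ((N : ℝ) + 1)) := by
  rw [sub_pos, div_lt_one (by positivity)]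
  linarith [(N.cast_nonneg : (0 : ℝ) ≤ N)]

theorem control_nonneg (I : Instance N) (α : ℝ) (T : ℕ) (s : State N) : 0 ≤ control I α T s := by
  have := one_sub_pos N
  unfold control
  positivity

theorem lintegral_control_le (I : Instance N) (rule : History N → Finset (Fin N))
    {α : ℝ} (hα : 0 ≤ α) (hα1 : α ≤ 1) {T : ℕ} (hT : 1 ≤ T) :
    ∫⁻ s, ENNReal.ofReal (control I α T s) ∂(algorithmLaw I rule hα T) ≤
      ENNReal.ofReal (controlBound N) := by
  have hρ := one_sub_pos N
  set ρ : ℝ := 1 - 1 / (2 * ((N : ℝ) + 1)) with hρdef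
  have hlam := tiltParam_pos N α hT
  rw [algorithmLaw, PMF.lintegral_toMeasure]
  have h1 : ∀ s : State N, ENNReal.ofReal (control I α T s) =
      ∑ i, (ENNReal.ofReal (Real.exp (tiltParam N α T / 2 * cumError I α i s.past)) +
        ENNReal.ofReal (Real.exp (-tiltParam N α T / 2 * cumError I α i s.past))) +
      ENNReal.ofReal (ρ ^ (T - 1))⁻¹ * ENNReal.ofReal ((1 / 2) ^ s.past.length) := by
    intro s
    rw [control, ENNReal.ofReal_add (by positivity) (by positivity),
      ENNReal.ofReal_sum_of_nonneg (fun i _ => by positivity),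
      ENNReal.ofReal_mul (by positivity)]
    congr 1
    exact Finset.sum_congr rfl fun i _ => ENNReal.ofReal_add (by positivity) (by positivity)
  simp only [h1]
  rw [PMF.mean_add, PMF.mean_sum, PMF.mean_const_mul]
  calc _ ≤ ∑ _i : Fin N, ENNReal.ofReal (2 * (Real.exp 2 + (N + 1))) +
        ENNReal.ofReal (ρ ^ (T - 1))⁻¹ * ENNReal.ofReal (ρ ^ (T - 1)) := by
        gcongr with i
        · rw [PMF.mean_add, two_mul, ENNReal.ofReal_add (by positivity) (by positivity)]
          exact add_le_add
            (mean_exp_half_mul_cumError_le I rule hα hα1 (T := T) (by omega) i (abs_of_pos hlam))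
            (mean_exp_half_mul_cumError_le I rule hα hα1 (T := T) (by omega) i
              (by rw [abs_neg, abs_of_pos hlam]))
        · exact mean_half_pow_le I rule hα (T - 1)
    _ = ENNReal.ofReal (controlBound N) := by
        rw [← ENNReal.ofReal_mul (by positivity), inv_mul_cancel₀ (by positivity),
          ← ENNReal.ofReal_sum_of_nonneg (fun i _ => by positivity),
          ← ENNReal.ofReal_add (by positivity) zero_le_one]
        simp [controlBound]

/-! ### From the control function to the estimation error -/

/-- For `L ≥ 1` the error is `|M_i - M_j| / L`, and `TR = κ/t` turns this into tilted units. The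
summand `1` and the maximum with `1` are there for `L = 0`. -/
theorem diffError_le (I : Instance N) {α : ℝ} (hα : 0 ≤ α) (hα1 : α ≤ 1) {T : ℕ} (hT : 1 ≤ T)
    (i j : Fin N) (s : State N) :
    diffError I α i j s ≤ errorRate α T *
      ((1 + 2 / tiltScale N * (tiltParam N α T / 2 * |cumError I α i s.past| +
        tiltParam N α T / 2 * |cumError I α j s.past|)) *
      (T / max (s.past.length : ℝ) 1)) := by
  have hκ := tiltScale_pos N
  have hlam := tiltParam_pos N α hT
  have hR := errorRate_pos α hT
  have hT0 : (0 : ℝ) < T := by exact_mod_cast hT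
  have hsum : 0 ≤ 2 / tiltScale N * (tiltParam N α T / 2 * |cumError I α i s.past| +
        tiltParam N α T / 2 * |cumError I α j s.past|) := by positivity
  rcases Nat.eq_zero_or_pos s.past.length with hL | hL
  · have h1 : diffError I α i j s ≤ 1 := by
      have hi0 := I.v_pos i
      have hi1 := I.v_le_one i
      have hj0 := I.v_pos j
      have hj1 := I.v_le_one j
      rw [diffError, vHat, vHat, hL, Nat.cast_zero, div_zero, div_zero, sub_zero, abs_le]
      constructor <;> linarith
    have h2 := one_le_mul_errorRate hα hα1 hT
    rw [hL, Nat.cast_zero, max_eq_right zero_le_one, div_one]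
    calc diffError I α i j s ≤ errorRate α T * (1 * T) := by linarith
      _ ≤ _ := by
        gcongr
        linarith
  · have hL1 : (1 : ℝ) ≤ s.past.length := by exact_mod_cast hL
    have hL0 : (0 : ℝ) < s.past.length := by linarith
    rw [max_eq_left hL1]
    have h1 : diffError I α i j s =
        |cumError I α i s.past - cumError I α j s.past| / s.past.length := by
      rw [diffError, vHat, vHat, ← abs_of_pos hL0, ← abs_div, abs_of_pos hL0, cumError, cumError]
      congr 1
      field_simp
      ring
    rw [h1]
    calc |cumError I α i s.past - cumError I α j s.past| / s.past.length ≤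
        (|cumError I α i s.past| + |cumError I α j s.past|) / s.past.length := by
          gcongr
          exact abs_sub _ _
      _ = errorRate α T * (2 / tiltScale N * (tiltParam N α T / 2 * |cumError I α i s.past| +
            tiltParam N α T / 2 * |cumError I α j s.past|) * (T / s.past.length)) := by
          rw [tiltParam]
          field_simp
      _ ≤ _ := by
          gcongr
          linarith

/-- The exponential rate at which it becomes unlikely that few epochs are completed. -/
noncomputable def epochRate (N : ℕ) : ℝ := -Real.log (1 - 1 / (2 * ((N : ℝ) + 1))) / 2

theorem epochRate_pos (N : ℕ) : 0 < epochRate N := by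
  have h : Real.log (1 - 1 / (2 * ((N : ℝ) + 1))) < 0 :=
    Real.log_neg (one_sub_pos N) (by linarith [show 0 < 1 / (2 * ((N : ℝ) + 1)) by positivity])
  unfold epochRate
  linarith

theorem exp_abs_le_control (I : Instance N) (α : ℝ) {T : ℕ} (hT : 1 ≤ T) (i : Fin N)
    (s : State N) :
    Real.exp (tiltParam N α T / 2 * |cumError I α i s.past|) ≤ control I α T s := by
  have hρ := one_sub_pos N
  have hlam := tiltParam_pos N α hT
  have h1 := Finset.single_le_sum (f := fun i =>
    Real.exp (tiltParam N α T / 2 * cumError I α i s.past) +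
      Real.exp (-tiltParam N α T / 2 * cumError I α i s.past)) (fun i _ => by positivity)
    (Finset.mem_univ i)
  have h2 : 0 ≤ ((1 - 1 / (2 * ((N : ℝ) + 1))) ^ (T - 1))⁻¹ * (1 / 2) ^ s.past.length := by
    positivity
  have h3 : Real.exp (tiltParam N α T / 2 * |cumError I α i s.past|) ≤
      Real.exp (tiltParam N α T / 2 * cumError I α i s.past) +
        Real.exp (-tiltParam N α T / 2 * cumError I α i s.past) := by
    rcases abs_choice (cumError I α i s.past) with h | h <;> rw [h]
    · linarith [Real.exp_pos (-tiltParam N α T / 2 * cumError I α i s.past)]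
    · rw [show tiltParam N α T / 2 * -cumError I α i s.past =
        -tiltParam N α T / 2 * cumError I α i s.past by ring]
      linarith [Real.exp_pos (tiltParam N α T / 2 * cumError I α i s.past)]
  unfold control
  linarith

theorem one_le_control (I : Instance N) (α : ℝ) {T : ℕ} (hT : 1 ≤ T) (i : Fin N)
    (s : State N) : 1 ≤ control I α T s := by
  have := tiltParam_pos N α hT
  exact (Real.one_le_exp (by positivity)).trans (exp_abs_le_control I α hT i s)

/-- Either a constant fraction of the time steps end an epoch, or the control is large. -/
theorem epoch_dichotomy (I : Instance N) (α : ℝ) {T : ℕ} (hT : 1 ≤ T) (s : State N) :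
    T / max (s.past.length : ℝ) 1 ≤ 1 / epochRate N ∨
      epochRate N * T ≤ Real.log (control I α T s) + 2 * epochRate N := by
  have hρ := one_sub_pos N
  have hc := epochRate_pos N
  have hT0 : (0 : ℝ) < T := by exact_mod_cast hT
  have hle : ((1 - 1 / (2 * ((N : ℝ) + 1))) ^ (T - 1))⁻¹ * (1 / 2) ^ s.past.length ≤
      control I α T s := by
    have : 0 ≤ ∑ i, (Real.exp (tiltParam N α T / 2 * cumError I α i s.past) +
      Real.exp (-tiltParam N α T / 2 * cumError I α i s.past)) := by positivity
    unfold control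
    linarith
  have hlog := Real.log_le_log (by positivity) hle
  rw [Real.log_mul (by positivity) (by positivity), Real.log_inv, Real.log_pow, Real.log_pow,
    one_div (2 : ℝ), Real.log_inv, Nat.cast_sub hT, Nat.cast_one,
    show Real.log (1 - 1 / (2 * ((N : ℝ) + 1))) = -(2 * epochRate N) by
      rw [epochRate]; ring] at hlog
  have hlog2 : Real.log 2 ≤ 1 := by linarith [Real.log_le_sub_one_of_pos (x := 2) (by norm_num)]
  -- With `c` the epoch rate, `hlog` contains `2c(T-1) - L log 2 ≤ log control`. Either `L log 2 ≥
  -- cT`, so `L` is proportional to `T`, or half of the exponent `2cT` survives.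
  rcases le_total (epochRate N * T) (s.past.length * Real.log 2) with h | h
  · left
    have hmax : (s.past.length : ℝ) ≤ max (s.past.length : ℝ) 1 := le_max_left _ _
    have hL0 : (0 : ℝ) ≤ s.past.length := Nat.cast_nonneg _
    have hm0 : (0 : ℝ) < max (s.past.length : ℝ) 1 := lt_max_of_lt_right one_pos
    rw [div_le_div_iff₀ hm0 hc]
    nlinarith
  · right
    linarith

theorem sq_le_two_mul_exp {x : ℝ} (hx : 0 ≤ x) : x ^ 2 ≤ 2 * Real.exp x := by
  linarith [Real.quadratic_le_exp_of_nonneg hx]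

/-- The constant in the pointwise bound of the error by the control. -/
noncomputable def pointwiseConst (N : ℕ) : ℝ :=
  1 + 32 / tiltScale N ^ 2 +
    (1 / epochRate N ^ 2 + 2 * Real.exp (2 * epochRate N) / epochRate N ^ 2) / 2

theorem diffError_le_mul_control (I : Instance N) {α : ℝ} (hα : 0 ≤ α) (hα1 : α ≤ 1) {T : ℕ}
    (hT : 1 ≤ T) (i j : Fin N) (s : State N) :
    diffError I α i j s ≤ errorRate α T * (pointwiseConst N * control I α T s) := by
  have hκ := tiltScale_pos N
  have hc := epochRate_pos N
  have hlam := tiltParam_pos N α hT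
  have hH1 := one_le_control I α hT i s
  have hi := exp_abs_le_control I α hT i s
  have hj := exp_abs_le_control I α hT j s
  have hT1 : (1 : ℝ) ≤ T := by exact_mod_cast hT
  refine (diffError_le I hα hα1 hT i j s).trans
    (mul_le_mul_of_nonneg_left ?_ (errorRate_pos α hT).le)
  have hdich := epoch_dichotomy I α hT s
  set H := control I α T s
  set x := tiltParam N α T / 2 * |cumError I α i s.past|
  set y := tiltParam N α T / 2 * |cumError I α j s.past|
  set Z := (T : ℝ) / max (s.past.length : ℝ) 1 with hZ
  have hx0 : 0 ≤ x := by positivity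
  have hy0 : 0 ≤ y := by positivity
  have hZ0 : 0 ≤ Z := by positivity
  have hx2 := sq_le_two_mul_exp hx0
  have hy2 := sq_le_two_mul_exp hy0
  have hZT : Z ≤ T := div_le_self (by linarith) (le_max_right _ _)
  have hZ2 : Z ^ 2 ≤
      (1 / epochRate N ^ 2 + 2 * Real.exp (2 * epochRate N) / epochRate N ^ 2) * H := by
    have hA : 0 ≤ 1 / epochRate N ^ 2 := by positivity
    have hB : 0 ≤ 2 * Real.exp (2 * epochRate N) / epochRate N ^ 2 := by positivity
    rcases hdich with h | h
    · calc Z ^ 2 ≤ (1 / epochRate N) ^ 2 := pow_le_pow_left₀ hZ0 h 2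
        _ = 1 / epochRate N ^ 2 := by rw [div_pow, one_pow]
        _ ≤ _ := by nlinarith
    -- With few epochs only `Z ≤ T` is available, but `e^(cT) ≤ control · e^(2c)` then pays for
    -- `T²`.
    · have h1 : (epochRate N * T) ^ 2 ≤ 2 * (H * Real.exp (2 * epochRate N)) := by
        refine (sq_le_two_mul_exp (by positivity)).trans ?_
        have := Real.exp_le_exp.2 h
        rw [Real.exp_add, Real.exp_log (by linarith)] at this
        linarith
      calc Z ^ 2 ≤ (T : ℝ) ^ 2 := pow_le_pow_left₀ hZ0 hZT 2
        _ = (epochRate N * T) ^ 2 / epochRate N ^ 2 := by field_simp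
        _ ≤ 2 * (H * Real.exp (2 * epochRate N)) / epochRate N ^ 2 := by gcongr
        _ = 2 * Real.exp (2 * epochRate N) / epochRate N ^ 2 * H := by ring
        _ ≤ _ := by nlinarith
  have hm : (2 / tiltScale N * (x + y)) ^ 2 ≤ 32 / tiltScale N ^ 2 * H := by
    calc (2 / tiltScale N * (x + y)) ^ 2 = 4 / tiltScale N ^ 2 * (x + y) ^ 2 := by ring
      _ ≤ 4 / tiltScale N ^ 2 * (8 * H) := by
          gcongr
          nlinarith [sq_nonneg (x - y)]
      _ = _ := by ring
  have hcH : 0 ≤ 32 / tiltScale N ^ 2 * H := by positivity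
  set m := 2 / tiltScale N * (x + y)
  unfold pointwiseConst
  -- `(1 + m) Z ≤ ((1 + m)² + Z²)/2 ≤ 1 + m² + Z²/2`, and each term is at most a constant times `H`.
  nlinarith [sq_nonneg (1 + m - Z), sq_nonneg (1 - m)]

/-- The constant in the bound of the error on the event that the control is at most
`controlBound N / δ`. -/
noncomputable def tailConst (N : ℕ) : ℝ :=
  (2 + 4 / tiltScale N * (2 * Real.log (controlBound N) + 1)) *
    (1 / epochRate N + 2 * Real.log (controlBound N) / epochRate N + 4)

theorem tailConst_pos (N : ℕ) : 0 < tailConst N := by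
  have hκ := tiltScale_pos N
  have hc := epochRate_pos N
  have hK := Real.log_nonneg (one_le_controlBound N)
  unfold tailConst
  positivity

/-- Taking logarithms, `log control ≤ log K - log δ` with `K` the control bound makes the tilted
errors `O(log (2/δ))`, while the lower bound on `δ` keeps `T/L` bounded. -/
theorem diffError_le_of_control_le (I : Instance N) {α : ℝ} (hα : 0 ≤ α) (hα1 : α ≤ 1) {T : ℕ}
    (hT : 1 ≤ T) {δ : ℝ} (hδ : Real.exp (-(epochRate N / 2 * T)) ≤ δ) (hδ1 : δ < 1)
    (i j : Fin N) (s : State N) (hs : control I α T s ≤ controlBound N / δ) :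
    diffError I α i j s ≤ tailConst N * Real.log (2 / δ) * errorRate α T := by
  have hκ := tiltScale_pos N
  have hc := epochRate_pos N
  have hlam := tiltParam_pos N α hT
  have hK1 := one_le_controlBound N
  have hK := Real.log_nonneg hK1
  have hδ0 : 0 < δ := (Real.exp_pos _).trans_le hδ
  have hH1 := one_le_control I α hT i s
  have hlogδ : -Real.log δ ≤ epochRate N / 2 * T := by
    have := (Real.le_log_iff_exp_le hδ0).2 hδ
    linarith
  have hlogH : Real.log (control I α T s) ≤ Real.log (controlBound N) - Real.log δ := by
    rw [← Real.log_div (by linarith) hδ0.ne']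
    exact Real.log_le_log (by linarith) hs
  have hℓ : Real.log (2 / δ) = Real.log 2 - Real.log δ := Real.log_div (by norm_num) hδ0.ne'
  -- Since `δ < 1`, this gives `log (2/δ) ≥ 1/2`, so additive constants can be absorbed into
  -- multiples of `log (2/δ)`.
  have hlog2 : 1 / 2 < Real.log 2 := by linarith [Real.log_two_gt_d9]
  have hlogδ0 : Real.log δ < 0 := Real.log_neg hδ0 hδ1
  have hx : tiltParam N α T / 2 * |cumError I α i s.past| ≤ Real.log (control I α T s) :=
    (Real.le_log_iff_exp_le (by linarith)).2 (exp_abs_le_control I α hT i s)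
  have hy : tiltParam N α T / 2 * |cumError I α j s.past| ≤ Real.log (control I α T s) :=
    (Real.le_log_iff_exp_le (by linarith)).2 (exp_abs_le_control I α hT j s)
  have hT1 : (1 : ℝ) ≤ T := by exact_mod_cast hT
  have hZ : T / max (s.past.length : ℝ) 1 ≤
      1 / epochRate N + 2 * Real.log (controlBound N) / epochRate N + 4 := by
    have h0 : 0 ≤ 1 / epochRate N := by positivity
    have h1 : 0 ≤ 2 * Real.log (controlBound N) / epochRate N := by positivity
    rcases epoch_dichotomy I α hT s with h | h
    · linarith
    · have h2 : (T : ℝ) / max (s.past.length : ℝ) 1 ≤ T :=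
        div_le_self (by linarith) (le_max_right _ _)
      -- Here `cT ≤ log K - log δ + 2c` and `-log δ ≤ cT/2`, so few epochs are possible only for
      -- bounded `T`.
      have h3 : (T : ℝ) ≤ 2 * Real.log (controlBound N) / epochRate N + 4 := by
        rw [← sub_le_iff_le_add, le_div_iff₀ hc]
        linarith
      linarith
  refine (diffError_le I hα hα1 hT i j s).trans ?_
  rw [mul_comm _ (errorRate α T)]
  refine mul_le_mul_of_nonneg_left ?_ (errorRate_pos α hT).le
  set ℓ := Real.log (2 / δ)
  have hℓ0 : 0 ≤ ℓ := by linarith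
  rw [tailConst, mul_right_comm]
  refine mul_le_mul ?_ hZ (by positivity) (by positivity)
  have hsum : tiltParam N α T / 2 * |cumError I α i s.past| +
      tiltParam N α T / 2 * |cumError I α j s.past| ≤
        2 * ((2 * Real.log (controlBound N) + 1) * ℓ) := by
    nlinarith
  calc _ ≤ 2 * ℓ + 2 / tiltScale N * (2 * ((2 * Real.log (controlBound N) + 1) * ℓ)) := by
        gcongr
        linarith
    _ = _ := by ring

/-! ### Integrability, expectation and Markov's inequality -/

instance (I : Instance N) (rule : History N → Finset (Fin N)) {α : ℝ} (hα : 0 ≤ α) (T : ℕ) :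
    MeasureTheory.IsProbabilityMeasure (algorithmLaw I rule hα T) := by
  unfold algorithmLaw
  infer_instance

theorem integrable_control (I : Instance N) (rule : History N → Finset (Fin N))
    {α : ℝ} (hα : 0 ≤ α) (hα1 : α ≤ 1) {T : ℕ} (hT : 1 ≤ T) :
    MeasureTheory.Integrable (control I α T) (algorithmLaw I rule hα T) := by
  refine ⟨Measurable.of_discrete.aestronglyMeasurable, ?_⟩
  rw [MeasureTheory.hasFiniteIntegral_iff_ofReal (.of_forall (control_nonneg I α T))]
  exact (lintegral_control_le I rule hα hα1 hT).trans_lt ENNReal.ofReal_lt_top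

theorem integral_control_le (I : Instance N) (rule : History N → Finset (Fin N))
    {α : ℝ} (hα : 0 ≤ α) (hα1 : α ≤ 1) {T : ℕ} (hT : 1 ≤ T) :
    ∫ s, control I α T s ∂(algorithmLaw I rule hα T) ≤ controlBound N := by
  rw [MeasureTheory.integral_eq_lintegral_of_nonneg_ae (.of_forall (control_nonneg I α T))
    Measurable.of_discrete.aestronglyMeasurable]
  exact ENNReal.toReal_le_of_le_ofReal (by linarith [one_le_controlBound N])
    (lintegral_control_le I rule hα hα1 hT)

theorem diffError_nonneg (I : Instance N) (α : ℝ) (i j : Fin N) (s : State N) :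
    0 ≤ diffError I α i j s := abs_nonneg _

theorem integrable_diffError (I : Instance N) (rule : History N → Finset (Fin N))
    {α : ℝ} (hα : 0 ≤ α) (hα1 : α ≤ 1) {T : ℕ} (hT : 1 ≤ T) (i j : Fin N) :
    MeasureTheory.Integrable (diffError I α i j) (algorithmLaw I rule hα T) := by
  refine (((integrable_control I rule hα hα1 hT).const_mul (pointwiseConst N)).const_mul
    (errorRate α T)).mono' Measurable.of_discrete.aestronglyMeasurable (.of_forall fun s => ?_)
  rw [Real.norm_of_nonneg (diffError_nonneg I α i j s)]
  exact diffError_le_mul_control I hα hα1 hT i j s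

theorem pointwiseConst_pos (N : ℕ) : 0 < pointwiseConst N := by
  have hκ := tiltScale_pos N
  have hc := epochRate_pos N
  unfold pointwiseConst
  positivity

theorem integral_diffError_le (I : Instance N) (rule : History N → Finset (Fin N))
    {α : ℝ} (hα : 0 ≤ α) (hα1 : α ≤ 1) {T : ℕ} (hT : 1 ≤ T) (i j : Fin N) :
    ∫ s, diffError I α i j s ∂(algorithmLaw I rule hα T) ≤
      pointwiseConst N * controlBound N * errorRate α T := by
  calc _ ≤ ∫ s, errorRate α T * (pointwiseConst N * control I α T s)
        ∂(algorithmLaw I rule hα T) :=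
        MeasureTheory.integral_mono (integrable_diffError I rule hα hα1 hT i j)
          (((integrable_control I rule hα hα1 hT).const_mul _).const_mul _)
          (diffError_le_mul_control I hα hα1 hT i j)
    _ = errorRate α T * (pointwiseConst N *
          ∫ s, control I α T s ∂(algorithmLaw I rule hα T)) := by
        rw [MeasureTheory.integral_const_mul, MeasureTheory.integral_const_mul]
    _ ≤ errorRate α T * (pointwiseConst N * controlBound N) := by
        have := errorRate_pos α hT
        have := pointwiseConst_pos N
        gcongr
        exact integral_control_le I rule hα hα1 hT
    _ = _ := mul_comm _ _

/-- Markov's inequality. The event does not mention a pair of items, so it serves all pairs without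
a union bound. -/
theorem one_sub_le_measureReal_control_le (I : Instance N) (rule : History N → Finset (Fin N))
    {α : ℝ} (hα : 0 ≤ α) (hα1 : α ≤ 1) {T : ℕ} (hT : 1 ≤ T) {δ : ℝ} (hδ : 0 < δ) :
    1 - δ ≤ (algorithmLaw I rule hα T).real {s | control I α T s ≤ controlBound N / δ} := by
  have hK : 0 < controlBound N := by linarith [one_le_controlBound N]
  have h1 := MeasureTheory.mul_meas_ge_le_integral_of_nonneg
    (.of_forall (control_nonneg I α T)) (integrable_control I rule hα hα1 hT)
    (controlBound N / δ)
  have h2 := h1.trans (integral_control_le I rule hα hα1 hT)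
  have h3 : (algorithmLaw I rule hα T).real {s | controlBound N / δ ≤ control I α T s} ≤ δ := by
    rw [div_mul_eq_mul_div, div_le_iff₀ hδ] at h2
    exact le_of_mul_le_mul_left h2 hK
  have h4 : (algorithmLaw I rule hα T).real {s | control I α T s ≤ controlBound N / δ}ᶜ ≤ δ := by
    refine le_trans (MeasureTheory.measureReal_mono ?_) h3
    exact fun s hs => (not_le.1 (Set.notMem_ofPred_iff.1 hs)).le
  rw [MeasureTheory.probReal_compl_eq_one_sub MeasurableSpace.measurableSet_top] at h4
  linarith

end MNLBandit

theorem corollary4p3 (N : ℕ) :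
    ∃ C c : ℝ, 0 < C ∧ 0 < c ∧
      ∀ (I : MNLBandit.Instance N) (α : ℝ) (hα : 0 ≤ α), α ≤ 1 / 2 →
      ∀ rule : MNLBandit.History N → Finset (Fin N), MNLBandit.IsOptimisticRule I rule →
      ∀ T : ℕ, 1 ≤ T →
        (∀ i j : Fin N, i ≠ j →
          MeasureTheory.Integrable (MNLBandit.diffError I α i j)
            (MNLBandit.algorithmLaw I rule hα T) ∧
          ∫ s, MNLBandit.diffError I α i j s ∂(MNLBandit.algorithmLaw I rule hα T)
            ≤ C * Real.sqrt ((T : ℝ) ^ (α - 1))) ∧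
        (∀ δ : ℝ, Real.exp (-(c * T)) ≤ δ → δ < 1 →
          1 - δ ≤ (MNLBandit.algorithmLaw I rule hα T).real
            {s | ∀ i j : Fin N, i ≠ j →
              MNLBandit.diffError I α i j s
                ≤ C * Real.log (2 / δ) * Real.sqrt ((T : ℝ) ^ (α - 1))}) := by
  have hA := MNLBandit.pointwiseConst_pos N
  have hB := MNLBandit.tailConst_pos N
  have hK : 0 < MNLBandit.controlBound N := by linarith [MNLBandit.one_le_controlBound N]
  have hc := MNLBandit.epochRate_pos N
  -- The sum of the two constants serves both claims; half the epoch rate is the range of `δ` in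
  -- which `T/L` stays bounded.
  refine ⟨MNLBandit.pointwiseConst N * MNLBandit.controlBound N + MNLBandit.tailConst N,
    MNLBandit.epochRate N / 2, by positivity, by positivity, ?_⟩
  intro I α hα hα2 rule _ T hT
  have hα1 : α ≤ 1 := by linarith
  have hR := MNLBandit.errorRate_pos α hT
  refine ⟨fun i j _ => ⟨MNLBandit.integrable_diffError I rule hα hα1 hT i j, ?_⟩, ?_⟩
  · refine (MNLBandit.integral_diffError_le I rule hα hα1 hT i j).trans
      (mul_le_mul_of_nonneg_right ?_ hR.le)
    linarith
  · intro δ hδ hδ1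
    have hδ0 : 0 < δ := (Real.exp_pos _).trans_le hδ
    refine (MNLBandit.one_sub_le_measureReal_control_le I rule hα hα1 hT hδ0).trans
      (MeasureTheory.measureReal_mono fun s hs i j _ => ?_)
    refine (MNLBandit.diffError_le_of_control_le I hα hα1 hT hδ hδ1 i j s hs).trans
      (mul_le_mul_of_nonneg_right (mul_le_mul_of_nonneg_right ?_ ?_) hR.le)
    · linarith [mul_pos hA hK]
    · refine Real.log_nonneg ?_
      rw [le_div_iff₀ hδ0]
      linarith
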